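/- Let $\mathbf{fRel}$ be the dagger symmetric monoidal category of finite sets and relations (tensor = cartesian product, dagger = converse relation). Let $\mathbb{G} = (A,X,Z)$ be an abelian internal group in $\mathbf{fRel}$, i.e. a finite set $A$ with two quasi-special commutative $\dagger$-Frobenius algebras $X = (\mu_X,\eta_X,\delta_X,\epsilon_X)$ (the group structure) and $Z = (\mu_Z,\eta_Z,\delta_Z,\epsilon_Z)$ (the point structure) on it (each is a commutative monoid $(\mu,\eta)$ that satisfies the Frobenius law with the comonoid $\delta=\mu^\dagger$, $\epsilon=\eta^\dagger$, and with $\mu\circ\delta = N\cdot\mathrm{id}_A$ for an invertible scalar $N$) that are strongly complementary: the comultiplication of each copies the unit of the other, $\epsilon_Z\circ\eta_X = \mathrm{id}_I$, $\epsilon_Z\circ\mu_X = \epsilon_Z\otimes\epsilon_Z$, and $\delta_Z\circ\mu_X = (\mu_X\otimes\mu_X)\circ(\mathrm{id}\otimes\mathrm{swap}\otimes\mathrm{id})\circ(\delta_Z\otimes\delta_Z)$. An abelian groupoid on $A$ is a partition of $A$ into disjoint subsets, each equipped with an abelian group structure; it corresponds to a $\dagger$-Frobenius algebra with multiplication $\mu$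 if $\mu$ sends $\{a\}\times\{b\}$ to $\{a+b\}$ when $a,b$ lie in the same member of the partition, and to $\emptyset$ otherwise. For a finite set $I$ and an abelian group $K$ write $\oplus^{|I|}K$ for an abelian groupoid with $|I|$ members, all isomorphic to $K$ as groups. A Hadamard transform (Fourier matrix) for $\mathbb{G}$ is an isomorphism $h:A\to A$ in $\mathbf{fRel}$ with $\delta_X\circ h = (h\otimes h)\circ\delta_Z$, $\epsilon_X\circ h = \epsilon_Z$, $h\circ\mu_X = \mu_Z\circ(h\otimes h)$ and $h\circ\eta_X = \eta_Z$. Then there are finite abelian groups $G$ and $H$ such that $Z$ corresponds to an abelian groupoid of the form $\oplus^{|G|}H$ and $X$ to one of the form $\oplus^{|H|}G$; and for any such $G$ and $H$, a Hadamard transform for $\mathbb{G}$ exists if and only if $G$ and $H$ are isomorphic. -/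

import Mathlib

open CategoryTheory MonoidalCategory

universe v u

/-! ## Dagger symmetric monoidal categories -/

/-- A dagger symmetric monoidal category: a symmetric monoidal category with an identity-on-objects
involutive contravariant functor `dag`, compatible with the tensor product, for which all the
structural isomorphisms are unitary. -/
class DaggerSMC (C : Type u) [Category.{v} C] [MonoidalCategory C] [SymmetricCategory C] where
  /-- The dagger (adjoint) of a morphism. -/
  dag : ∀ {X Y : C}, (X ⟶ Y) → (Y ⟶ X)
  dag_id : ∀ X : C, dag (𝟙 X) = 𝟙 X
  dag_comp : ∀ {X Y Z : C} (f : X ⟶ Y) (g : Y ⟶ Z), dag (f ≫ g) = dag g ≫ dag f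
  dag_dag : ∀ {X Y : C} (f : X ⟶ Y), dag (dag f) = f
  dag_tensor : ∀ {X Y X' Y' : C} (f : X ⟶ Y) (g : X' ⟶ Y'), dag (f ⊗ₘ g) = dag f ⊗ₘ dag g
  dag_associator : ∀ X Y Z : C, dag (α_ X Y Z).hom = (α_ X Y Z).inv
  dag_leftUnitor : ∀ X : C, dag (λ_ X).hom = (λ_ X).inv
  dag_rightUnitor : ∀ X : C, dag (ρ_ X).hom = (ρ_ X).inv
  dag_braiding : ∀ X Y : C, dag (β_ X Y).hom = (β_ X Y).inv

open DaggerSMC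

/-- A dagger-Frobenius algebra on an object `A`: a monoid on `A` which, together with the comonoid
obtained from it by the dagger, satisfies the Frobenius law. -/
structure DaggerFrobenius {C : Type u} [Category.{v} C] [MonoidalCategory C] [SymmetricCategory C]
    [DaggerSMC C] (A : C) where
  /-- The unit. -/
  one : 𝟙_ C ⟶ A
  /-- The multiplication. -/
  mul : A ⊗ A ⟶ A
  one_mul : (one ▷ A) ≫ mul = (λ_ A).hom
  mul_one : (A ◁ one) ≫ mul = (ρ_ A).hom
  mul_assoc : (mul ▷ A) ≫ mul = (α_ A A A).hom ≫ (A ◁ mul) ≫ mul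
  frobenius_left : (A ◁ dag mul) ≫ (α_ A A A).inv ≫ (mul ▷ A) = mul ≫ dag mul
  frobenius_right : (dag mul ▷ A) ≫ (α_ A A A).hom ≫ (A ◁ mul) = mul ≫ dag mul

namespace DaggerFrobenius

variable {C : Type u} [Category.{v} C] [MonoidalCategory C] [SymmetricCategory C] [DaggerSMC C]
  {A : C}

/-- The comultiplication of a dagger-Frobenius algebra. -/
def comul (F : DaggerFrobenius A) : A ⟶ A ⊗ A := dag F.mul

/-- The counit of a dagger-Frobenius algebra. -/
def counit (F : DaggerFrobenius A) : A ⟶ 𝟙_ C := dag F.one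

/-- Commutativity of a dagger-Frobenius algebra. -/
def IsCommutative (F : DaggerFrobenius A) : Prop := (β_ A A).hom ≫ F.mul = F.mul

/-- Quasi-speciality: multiplication after comultiplication is an invertible scalar `N` times
the identity. -/
def IsQuasiSpecial (F : DaggerFrobenius A) : Prop :=
  ∃ N : 𝟙_ C ⟶ 𝟙_ C, IsIso N ∧ F.comul ≫ F.mul = (λ_ A).inv ≫ (N ▷ A) ≫ (λ_ A).hom

/-- Coherence of two dagger-Frobenius algebras: each comultiplication copies the unit of the other
algebra, and the counit of one after the unit of the other is the identity scalar. -/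
structure Coherent (Z X : DaggerFrobenius A) : Prop where
  copy_left : X.one ≫ Z.comul = (λ_ (𝟙_ C)).inv ≫ (X.one ⊗ₘ X.one)
  copy_right : Z.one ≫ X.comul = (λ_ (𝟙_ C)).inv ≫ (Z.one ⊗ₘ Z.one)
  unit_counit : X.one ≫ Z.counit = 𝟙 (𝟙_ C)

/-- Strong complementarity of two dagger-Frobenius algebras: coherence and the bialgebra
equations. -/
structure StronglyComplementary (Z X : DaggerFrobenius A) : Prop where
  coherent : Coherent Z X
  bialgebra : X.mul ≫ Z.comul = (Z.comul ⊗ₘ Z.comul) ≫ tensorμ A A A A ≫ (X.mul ⊗ₘ X.mul)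
  unit_comul : X.one ≫ Z.comul = (λ_ (𝟙_ C)).inv ≫ (X.one ⊗ₘ X.one)
  mul_counit : X.mul ≫ Z.counit = (Z.counit ⊗ₘ Z.counit) ≫ (λ_ (𝟙_ C)).hom

end DaggerFrobenius

/-- An internal group `(A, X, Z)` on an object `A` of a dagger symmetric monoidal category: the
group structure `X` is a quasi-special dagger-Frobenius algebra, the point structure `Z` is a
quasi-special commutative dagger-Frobenius algebra, and the two are strongly complementary. -/
structure InternalGroup {C : Type u} [Category.{v} C] [MonoidalCategory C] [SymmetricCategory C]
    [DaggerSMC C] (A : C) where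
  /-- The group structure. -/
  X : DaggerFrobenius A
  /-- The point structure. -/
  Z : DaggerFrobenius A
  quasiSpecial_X : X.IsQuasiSpecial
  quasiSpecial_Z : Z.IsQuasiSpecial
  commutative_Z : Z.IsCommutative
  stronglyComplementary : DaggerFrobenius.StronglyComplementary Z X

namespace InternalGroup

variable {C : Type u} [Category.{v} C] [MonoidalCategory C] [SymmetricCategory C] [DaggerSMC C]
  {A : C}

/-- An internal group is abelian when its group structure is commutative. -/
def IsAbelian (𝔾 : InternalGroup A) : Prop := 𝔾.X.IsCommutative

/-- A Hadamard transform (Fourier matrix) for an internal group `(A, X, Z)`: an isomorphism from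
the comonoid of `Z` to the comonoid of `X` that is also an isomorphism from the monoid of `X` to
the monoid of `Z`. -/
structure Hadamard (𝔾 : InternalGroup A) where
  /-- The underlying isomorphism. -/
  h : A ≅ A
  map_comul : h.hom ≫ 𝔾.X.comul = 𝔾.Z.comul ≫ (h.hom ⊗ₘ h.hom)
  map_counit : h.hom ≫ 𝔾.X.counit = 𝔾.Z.counit
  map_mul : 𝔾.X.mul ≫ h.hom = (h.hom ⊗ₘ h.hom) ≫ 𝔾.Z.mul
  map_one : 𝔾.X.one ≫ h.hom = 𝔾.Z.one

end InternalGroup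

/-! ## The category of finite sets and relations -/

/-- Finite sets, as objects of the category of finite sets and relations. -/
structure FRel : Type (u + 1) where
  /-- The underlying set. -/
  carrier : Type u
  [finite : Finite carrier]

attribute [instance] FRel.finite

namespace FRel

instance : CoeSort FRel.{u} (Type u) := ⟨FRel.carrier⟩

/-- Morphisms of `FRel`: arbitrary binary relations. -/
@[ext]
structure Hom (A B : FRel.{u}) : Type u where
  /-- The underlying relation. -/
  rel : A → B → Prop

/-- Morphisms are composed as relations. -/
instance : Category.{u} FRel.{u} where
  Hom := Hom
  id A := ⟨fun a b => a = b⟩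
  comp f g := ⟨fun a c => ∃ b, f.rel a b ∧ g.rel b c⟩
  id_comp f := by apply Hom.ext; funext a b; simp
  comp_id f := by apply Hom.ext; funext a b; simp
  assoc f g h := by
    apply Hom.ext; funext a b; simp only [eq_iff_iff]
    constructor
    · rintro ⟨c, ⟨d, h1, h2⟩, h3⟩; exact ⟨d, h1, c, h2, h3⟩
    · rintro ⟨d, h1, c, h2, h3⟩; exact ⟨c, ⟨d, h1, h2⟩, h3⟩

variable {A B D : FRel.{u}}

theorem hom_ext {f g : A ⟶ B} (h : ∀ a b, f.rel a b ↔ g.rel a b) : f = g :=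
  Hom.ext (funext fun a => funext fun b => propext (h a b))

@[simp] theorem id_rel (a b : A) : (𝟙 A : A ⟶ A).rel a b ↔ a = b := Iff.rfl

@[simp] theorem comp_rel (f : A ⟶ B) (g : B ⟶ D) (a : A) (c : D) :
    (f ≫ g).rel a c ↔ ∃ b, f.rel a b ∧ g.rel b c := Iff.rfl

/-- The isomorphism of `FRel` given by the graph of a bijection. -/
@[simps]
def isoOfEquiv (e : A ≃ B) : A ≅ B where
  hom := ⟨fun a b => e a = b⟩
  inv := ⟨fun b a => e a = b⟩
  hom_inv_id := hom_ext fun a b => by simp [eq_comm]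
  inv_hom_id := hom_ext fun a b => by
    simp only [comp_rel, id_rel]
    exact ⟨fun ⟨c, h1, h2⟩ => h1.symm.trans h2, fun h => ⟨e.symm a, by simp, by simpa using h⟩⟩

/-- The tensor product of `FRel` is the cartesian product, the unit is the one-element set. -/
instance : MonoidalCategoryStruct FRel.{u} where
  tensorObj A B := ⟨A × B⟩
  whiskerLeft _ _ _ f := ⟨fun p q => p.1 = q.1 ∧ f.rel p.2 q.2⟩
  whiskerRight f _ := ⟨fun p q => f.rel p.1 q.1 ∧ p.2 = q.2⟩
  tensorHom f g := ⟨fun p q => f.rel p.1 q.1 ∧ g.rel p.2 q.2⟩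
  tensorUnit := ⟨PUnit⟩
  associator A B D := isoOfEquiv (Equiv.prodAssoc A B D)
  leftUnitor A := isoOfEquiv (Equiv.punitProd A)
  rightUnitor A := isoOfEquiv (Equiv.prodPUnit A)

@[simp] theorem tensorObj_carrier (A B : FRel.{u}) : (A ⊗ B).carrier = (A × B) := rfl

@[simp] theorem tensorUnit_carrier : (𝟙_ FRel.{u}).carrier = PUnit.{u + 1} := rfl

section
variable {A' B' : FRel.{u}}

@[simp] theorem whiskerLeft_rel (f : A ⟶ B) (p : D × A) (q : D × B) :
    (D ◁ f).rel p q ↔ p.1 = q.1 ∧ f.rel p.2 q.2 := Iff.rfl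

@[simp] theorem whiskerRight_rel (f : A ⟶ B) (p : A × D) (q : B × D) :
    (f ▷ D).rel p q ↔ f.rel p.1 q.1 ∧ p.2 = q.2 := Iff.rfl

@[simp] theorem tensorHom_rel (f : A ⟶ B) (g : A' ⟶ B') (p : A × A') (q : B × B') :
    (f ⊗ₘ g).rel p q ↔ f.rel p.1 q.1 ∧ g.rel p.2 q.2 := Iff.rfl

@[simp] theorem associator_hom_rel (p : (A × B) × D) (q : A × B × D) :
    (α_ A B D).hom.rel p q ↔ (p.1.1, p.1.2, p.2) = q := Iff.rfl

@[simp] theorem associator_inv_rel (p : A × B × D) (q : (A × B) × D) :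
    (α_ A B D).inv.rel p q ↔ (q.1.1, q.1.2, q.2) = p := Iff.rfl

@[simp] theorem leftUnitor_hom_rel (p : PUnit.{u + 1} × A) (a : A) :
    (λ_ A).hom.rel p a ↔ p.2 = a := Iff.rfl

@[simp] theorem leftUnitor_inv_rel (a : A) (p : PUnit.{u + 1} × A) :
    (λ_ A).inv.rel a p ↔ p.2 = a := Iff.rfl

@[simp] theorem rightUnitor_hom_rel (p : A × PUnit.{u + 1}) (a : A) :
    (ρ_ A).hom.rel p a ↔ p.1 = a := Iff.rfl

@[simp] theorem rightUnitor_inv_rel (a : A) (p : A × PUnit.{u + 1}) :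
    (ρ_ A).inv.rel a p ↔ p.1 = a := Iff.rfl

end

instance : MonoidalCategory FRel.{u} where
  tensorHom_def _ _ := hom_ext fun ⟨_, _⟩ ⟨_, _⟩ => by
    simp
  id_tensorHom_id _ _ := hom_ext fun ⟨_, _⟩ ⟨_, _⟩ => by
    simp
  tensorHom_comp_tensorHom _ _ _ _ := hom_ext fun ⟨_, _⟩ ⟨_, _⟩ => by
    simp; grind
  whiskerLeft_id _ _ := hom_ext fun ⟨_, _⟩ ⟨_, _⟩ => by
    simp
  id_whiskerRight _ _ := hom_ext fun ⟨_, _⟩ ⟨_, _⟩ => by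
    simp
  associator_naturality _ _ _ := hom_ext fun ⟨⟨_, _⟩, _⟩ ⟨_, _, _⟩ => by
    simp; grind
  leftUnitor_naturality _ := hom_ext fun ⟨_, _⟩ _ => by
    simp
  rightUnitor_naturality _ := hom_ext fun ⟨_, _⟩ _ => by
    simp
  pentagon _ _ _ _ := hom_ext fun ⟨⟨⟨_, _⟩, _⟩, _⟩ ⟨_, _, _, _⟩ => by
    simp
  triangle _ _ := hom_ext fun ⟨⟨_, _⟩, _⟩ ⟨_, _⟩ => by
    simp

/-- The symmetry of `FRel` swaps the two components. -/
instance : SymmetricCategory FRel.{u} where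
  braiding A B := isoOfEquiv (Equiv.prodComm A B)
  braiding_naturality_right _ _ _ _ := hom_ext fun ⟨_, _⟩ ⟨_, _⟩ => by
    simp [and_comm]
  braiding_naturality_left _ _ := hom_ext fun ⟨_, _⟩ ⟨_, _⟩ => by
    simp [and_comm]
  hexagon_forward _ _ _ := hom_ext fun ⟨⟨_, _⟩, _⟩ ⟨_, _, _⟩ => by
    simp
  hexagon_reverse _ _ _ := hom_ext fun ⟨_, _, _⟩ ⟨⟨_, _⟩, _⟩ => by
    simp; grind
  symmetry _ _ := hom_ext fun ⟨_, _⟩ ⟨_, _⟩ => by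
    simp

@[simp] theorem braiding_hom_rel (p : A × B) (q : B × A) :
    (β_ A B).hom.rel p q ↔ (p.2, p.1) = q := Iff.rfl

@[simp] theorem braiding_inv_rel (p : B × A) (q : A × B) :
    (β_ A B).inv.rel p q ↔ (q.2, q.1) = p := Iff.rfl

/-- The dagger of `FRel` is the converse relation. -/
instance : DaggerSMC FRel.{u} where
  dag f := ⟨fun b a => f.rel a b⟩
  dag_id _ := hom_ext fun _ _ => eq_comm
  dag_comp _ _ := hom_ext fun _ _ => exists_congr fun _ => and_comm
  dag_dag _ := rfl
  dag_tensor _ _ := rfl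
  dag_associator _ _ _ := rfl
  dag_leftUnitor _ := rfl
  dag_rightUnitor _ := rfl
  dag_braiding _ _ := rfl

@[simp] theorem dag_rel (f : A ⟶ B) (b : B) (a : A) : (dag f).rel b a ↔ f.rel a b := Iff.rfl

@[simp] theorem tensorμ_rel (A₁ A₂ B₁ B₂ : FRel.{u}) (p : (A₁ × A₂) × B₁ × B₂)
    (q : (A₁ × B₁) × A₂ × B₂) :
    (tensorμ A₁ A₂ B₁ B₂).rel p q ↔ q = ((p.1.1, p.2.1), p.1.2, p.2.2) := by
  obtain ⟨⟨_, _⟩, _, _⟩ := p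
  obtain ⟨⟨_, _⟩, _, _⟩ := q
  simp [tensorμ]; grind

end FRel

/-! ## Abelian groupoids -/

/-- An abelian groupoid on a set `A`: a partition of `A` into disjoint subsets indexed by `ι`, each
of which carries the structure of an abelian group. -/
structure AbelianGroupoid (ι : Type v) (A : Type u) where
  /-- The members of the partition. -/
  part : ι → Set A
  /-- The group structures. -/
  group : ∀ i, AddCommGroup (part i)
  existsUnique_mem : ∀ a, ∃! i, a ∈ part i

attribute [instance] AbelianGroupoid.group

/-- An abelian groupoid on a finite set `A` corresponds to a dagger-Frobenius algebra on `A` in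
`FRel` when the multiplication sends `{a} × {b}` to `{a + b}` if `a` and `b` lie in the same member
of the partition, and to the empty set otherwise. -/
def AbelianGroupoid.CorrespondsTo {ι : Type v} {A : FRel.{u}} (P : AbelianGroupoid ι A)
    (F : DaggerFrobenius A) : Prop :=
  ∀ a b c : A, F.mul.rel (a, b) c ↔
    ∃ (i : ι) (ha : a ∈ P.part i) (hb : b ∈ P.part i),
      c = ((⟨a, ha⟩ + ⟨b, hb⟩ : P.part i) : A)

/-- A dagger-Frobenius algebra in `FRel` corresponds to the abelian groupoid `⊕^{|ι|} K`, that is,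
to an abelian groupoid with members indexed by `ι` that are all isomorphic to `K` as groups. -/
def CorrespondsToCopies {A : FRel.{u}} (F : DaggerFrobenius A) (ι : Type*) (K : Type*)
    [AddCommGroup K] : Prop :=
  ∃ P : AbelianGroupoid ι A, P.CorrespondsTo F ∧ ∀ i, Nonempty (P.part i ≃+ K)

/-! ## Abelian groupoids as ternary relations -/

/-! Read as ternary relations, the two algebras are abelian groupoids: invertible scalars are
trivial, so quasi-speciality makes addition single-valued, and the Frobenius law supplies inverses
(`FRel.isAbelianRel`).

Let `E` and `E'` be the identities of `Z` and of `X`. By copying, `E'` is a group `H` under `Z` and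
`E` is a group `G` under `X`. Sending each point to its two identities is injective
(`unit_prod_injective`) and surjective (`exists_of_units`), so `A` is a grid `G × H`. Taking
`Z`-identities respects `X`-addition and conversely (`unit_rel`), so `Z` adds second coordinates
within a fixed first one, and `X` does the reverse.

Isomorphisms of `FRel` are bijections. A Hadamard transform therefore carries a member of `X`, a
copy of `G`, onto a member of `Z`, a copy of `H`. Conversely, `θ : G ≃+ H` yields the transform `(g,
h) ↦ (θ⁻¹ h, θ g)`. -/

/-- `IsAbelianRel M E`: the ternary relation `M a b c`, read as `a + b = c`, is the partial addition
of an abelian groupoid whose set of identities is `E`. -/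
structure IsAbelianRel {S : Type u} (M : S → S → S → Prop) (E : S → Prop) : Prop where
  unique : ∀ {a b c d}, M a b c → M a b d → c = d
  comm : ∀ {a b c}, M a b c → M b a c
  assoc : ∀ {a b c x y}, M a b x → M x c y → ∃ z, M b c z ∧ M a z y
  unit_eq : ∀ {e a c}, E e → M e a c → a = c
  exists_unit : ∀ a, ∃ e, E e ∧ M e a a
  exists_neg : ∀ {e a}, E e → M e a a → ∃ x, M x a e

namespace IsAbelianRel

variable {S : Type u} {M : S → S → S → Prop} {E : S → Prop}

theorem assoc' (hM : IsAbelianRel M E) {a b c y z : S} (h : M b c z) (h' : M a z y) :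
    ∃ x, M a b x ∧ M x c y :=
  let ⟨w, hw, hw'⟩ := hM.assoc (hM.comm h) (hM.comm h')
  ⟨w, hM.comm hw, hM.comm hw'⟩

/-- Reassociating `e + (e' + a)` shows that `e + e'` is defined; this sum equals both `e` and `e'`.
-/
theorem unit_unique (hM : IsAbelianRel M E) {e e' a c c' : S} (he : E e) (he' : E e')
    (h : M e a c) (h' : M e' a c') : e = e' := by
  obtain rfl := hM.unit_eq he h
  obtain rfl := hM.unit_eq he' h'
  obtain ⟨x, hx, -⟩ := hM.assoc' h h'
  exact (hM.unit_eq he' hx).trans (hM.unit_eq he (hM.comm hx)).symm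

/-- The identity of the component of `a`. -/
noncomputable def unit (hM : IsAbelianRel M E) (a : S) : {e // E e} :=
  ⟨(hM.exists_unit a).choose, (hM.exists_unit a).choose_spec.1⟩

theorem unit_spec (hM : IsAbelianRel M E) (a : S) : M (hM.unit a) a a :=
  (hM.exists_unit a).choose_spec.2

theorem unit_eq_of_rel (hM : IsAbelianRel M E) {e a c : S} (he : E e) (h : M e a c) :
    (hM.unit a : S) = e :=
  hM.unit_unique (hM.unit a).2 he (hM.unit_spec a) h

theorem unit_of_mem (hM : IsAbelianRel M E) {e : S} (he : E e) : (hM.unit e : S) = e :=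
  hM.unit_eq he (hM.comm (hM.unit_spec e))

theorem unit_left (hM : IsAbelianRel M E) {a b c : S} (h : M a b c) : hM.unit c = hM.unit a := by
  obtain ⟨z, hz, h'⟩ := hM.assoc (hM.unit_spec a) h
  obtain rfl := hM.unique h hz
  exact Subtype.ext (hM.unit_eq_of_rel (hM.unit a).2 h')

theorem unit_right (hM : IsAbelianRel M E) {a b c : S} (h : M a b c) : hM.unit c = hM.unit b :=
  hM.unit_left (hM.comm h)

theorem exists_rel (hM : IsAbelianRel M E) {a b : S} (h : hM.unit a = hM.unit b) :
    ∃ c, M a b c := by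
  obtain ⟨x, hx⟩ := hM.exists_neg (hM.unit a).2 (hM.unit_spec a)
  obtain ⟨z, hz, -⟩ := hM.assoc hx (h ▸ hM.unit_spec b)
  exact ⟨z, hz⟩

theorem cancel (hM : IsAbelianRel M E) {a b c d : S} (hb : M a b d) (hc : M a c d) : b = c := by
  obtain ⟨x, hx⟩ := hM.exists_neg (hM.unit a).2 (hM.unit_spec a)
  obtain ⟨y, hy⟩ := hM.exists_rel
    (((hM.unit_left hx).symm.trans (hM.unit_right hx)).trans (hM.unit_left hb).symm)
  have key : ∀ {b}, M a b d → b = y := fun {b} hb => by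
    obtain ⟨w, hw, hw'⟩ := hM.assoc' hb hy
    obtain rfl := hM.unique hx hw
    exact hM.unit_eq (hM.unit a).2 hw'
  exact (key hb).trans (key hc).symm

/-- The identities of an abelian groupoid are determined by its addition. -/
theorem mem_iff (hM : IsAbelianRel M E) (e : S) : E e ↔ ∀ a c, M e a c → a = c := by
  refine ⟨fun he a c => hM.unit_eq he, fun h => ?_⟩
  have := h _ _ (hM.comm (hM.unit_spec e))
  exact this ▸ (hM.unit e).2

end IsAbelianRel

/-! ### Complementary pairs of abelian groupoids -/

/-- Two abelian groupoid structures on the same set that satisfy the relational form of strong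
complementarity. -/
structure ComplementaryRel {S : Type u} (M : S → S → S → Prop) (E : S → Prop)
    (M' : S → S → S → Prop) (E' : S → Prop) : Prop where
  left : IsAbelianRel M E
  right : IsAbelianRel M' E'
  copy_left : ∀ a b, (∃ c, E' c ∧ M a b c) ↔ E' a ∧ E' b
  copy_right : ∀ a b, (∃ c, E c ∧ M' a b c) ↔ E a ∧ E b
  bialgebra : ∀ a b c d, (∃ m, M' a b m ∧ M c d m) ↔
    ∃ a₁ a₂ b₁ b₂, M a₁ a₂ a ∧ M b₁ b₂ b ∧ M' a₁ b₁ c ∧ M' a₂ b₂ d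
  exists_common : ∃ z, E z ∧ E' z

namespace ComplementaryRel

variable {S : Type u} {M M' : S → S → S → Prop} {E E' : S → Prop}

/-- The bialgebra law is self-dual: taking converses and exchanging `a₂` with `b₁` swaps the two
structures. Each later result thus has a mirror image. -/
theorem symm (hC : ComplementaryRel M E M' E') : ComplementaryRel M' E' M E where
  left := hC.right
  right := hC.left
  copy_left := hC.copy_right
  copy_right := hC.copy_left
  bialgebra a b c d := by
    rw [show (∃ m, M a b m ∧ M' c d m) ↔ ∃ m, M' c d m ∧ M a b m from
      exists_congr fun _ => and_comm, hC.bialgebra]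
    constructor
    · rintro ⟨a₁, a₂, b₁, b₂, h₁, h₂, h₃, h₄⟩
      exact ⟨a₁, b₁, a₂, b₂, h₃, h₄, h₁, h₂⟩
    · rintro ⟨a₁, a₂, b₁, b₂, h₁, h₂, h₃, h₄⟩
      exact ⟨a₁, b₁, a₂, b₂, h₃, h₄, h₁, h₂⟩
  exists_common := hC.exists_common.imp fun _ h => h.symm

theorem exists_add (hC : ComplementaryRel M E M' E') (a b : {a // E' a}) :
    ∃ c : {a // E' a}, M a b c :=
  let ⟨c, hc, h⟩ := (hC.copy_left a b).2 ⟨a.2, b.2⟩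
  ⟨⟨c, hc⟩, h⟩

theorem common_rel (hC : ComplementaryRel M E M' E') {z a : S} (hz : E z) (hz' : E' z)
    (ha : E' a) : M z a a := by
  obtain ⟨c, -, h⟩ := (hC.copy_left z a).2 ⟨hz', ha⟩
  have := hC.left.unit_eq hz h
  rwa [← this] at h

theorem exists_neg (hC : ComplementaryRel M E M' E') {z : S} (hz : E z) (hz' : E' z)
    (a : {a // E' a}) : ∃ x : {a // E' a}, M x a z :=
  let ⟨x, hx⟩ := hC.left.exists_neg hz (hC.common_rel hz hz' a.2)
  ⟨⟨x, ((hC.copy_left x a).1 ⟨z, hz', hx⟩).1⟩, hx⟩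

/-- The identities of the second structure form a group under the addition of the first. -/
noncomputable abbrev unitGroup (hC : ComplementaryRel M E M' E') : AddCommGroup {a // E' a} :=
  let z := hC.exists_common.choose
  have hz : E z := hC.exists_common.choose_spec.1
  have hz' : E' z := hC.exists_common.choose_spec.2
  let add (a b : {a // E' a}) := (hC.exists_add a b).choose
  have hadd (a b : {a // E' a}) : M a b (add a b) := (hC.exists_add a b).choose_spec
  have eq_add {a b c : {a // E' a}} (h : M a b c) : add a b = c :=
    Subtype.ext (hC.left.unique (hadd a b) h)
  letI : Add {a // E' a} := ⟨add⟩
  letI : Zero {a // E' a} := ⟨⟨z, hz'⟩⟩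
  letI : Neg {a // E' a} := ⟨fun a => (hC.exists_neg hz hz' a).choose⟩
  { add_assoc := fun a b c => by
      obtain ⟨x, hx, h⟩ := hC.left.assoc (hadd a b) (hadd (add a b) c)
      exact Subtype.ext (hC.left.unique h (hC.left.unique hx (hadd b c) ▸ hadd a (add b c)))
    zero_add := fun a => eq_add (hC.common_rel hz hz' a.2)
    add_zero := fun a => eq_add (hC.left.comm (hC.common_rel hz hz' a.2))
    neg_add_cancel := fun a => eq_add (c := ⟨z, hz'⟩) (hC.exists_neg hz hz' a).choose_spec
    add_comm := fun a b => eq_add (hC.left.comm (hadd b a))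
    nsmul := nsmulRec
    zsmul := zsmulRec }

theorem unitGroup_rel (hC : ComplementaryRel M E M' E') (a b c : {a // E' a}) :
    M a b c ↔ c = letI := hC.unitGroup; a + b := by
  have h : M a b (letI := hC.unitGroup; (a + b : {a // E' a})) := (hC.exists_add a b).choose_spec
  exact ⟨fun h' => Subtype.ext (hC.left.unique h' h), fun h' => h' ▸ h⟩

/-- The bialgebra law is applied to `c = c + unit c`. It splits `a` and `b` so that the second
summands have `M'`-sum `unit c`; copying then forces these summands to be identities, hence `unit a`
and `unit b`. -/
theorem unit_rel (hC : ComplementaryRel M E M' E') {a b c : S} (h : M' a b c) :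
    M' (hC.left.unit a) (hC.left.unit b) (hC.left.unit c) := by
  have hM := hC.left
  obtain ⟨a₁, a₂, b₁, b₂, h₁, h₂, -, h₄⟩ := (hC.bialgebra a b c (hM.unit c)).1
    ⟨c, h, hM.comm (hM.unit_spec c)⟩
  obtain ⟨ha, hb⟩ := (hC.copy_right a₂ b₂).1 ⟨_, (hM.unit c).2, h₄⟩
  have ha' := hM.unit_eq ha (hM.comm h₁)
  have hb' := hM.unit_eq hb (hM.comm h₂)
  subst ha' hb'
  rwa [hM.unit_eq_of_rel ha (hM.comm h₁), hM.unit_eq_of_rel hb (hM.comm h₂)]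

theorem mem_of_unit_mem (hC : ComplementaryRel M E M' E') {a : S} (h : E' (hC.left.unit a)) :
    E' a := by
  obtain ⟨x, hx⟩ := hC.left.exists_neg (hC.left.unit a).2 (hC.left.unit_spec a)
  exact ((hC.copy_left x a).1 ⟨_, h, hx⟩).2

theorem unit_mem (hC : ComplementaryRel M E M' E') {a : S} (h : E' a) :
    E' (hC.left.unit a) :=
  ((hC.copy_left _ a).1 ⟨a, h, hC.left.unit_spec a⟩).1

theorem unit_prod_injective (hC : ComplementaryRel M E M' E') {a b : S}
    (h : hC.left.unit a = hC.left.unit b) (h' : hC.right.unit a = hC.right.unit b) : a = b := by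
  have hM := hC.left
  have hM' := hC.right
  obtain ⟨x, hx⟩ := hM'.exists_neg (hM'.unit b).2 (hM'.unit_spec b)
  -- `c` is the `M'`-difference of `a` and `b`. Its `M`-identity is that of an element of `E'`, so
  -- `c` itself lies in `E'` and the difference is trivial.
  obtain ⟨c, hc⟩ := hM'.exists_rel (h'.trans ((hM'.unit_right hx).symm.trans (hM'.unit_left hx)))
  have hc' := hC.unit_rel hc
  have hx' := hC.unit_rel (hM'.comm hx)
  rw [h] at hc'
  have hcE : E' c := hC.mem_of_unit_mem <| by
    rw [hM'.unique hc' hx']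
    exact hC.unit_mem (hM'.unit b).2
  have : c = hM'.unit b := by
    rw [← h', ← hM'.unit_left hc, hM'.unit_of_mem hcE]
  rw [this] at hc
  exact hM'.cancel (hM'.comm hc) hx

theorem exists_of_units (hC : ComplementaryRel M E M' E') (g : {a // E a}) (x : {a // E' a}) :
    ∃ a, hC.left.unit a = g ∧ hC.right.unit a = x := by
  obtain ⟨z, hz, hz'⟩ := hC.exists_common
  obtain ⟨g', hg'⟩ := hC.symm.exists_neg hz' hz g
  obtain ⟨x', hx'⟩ := hC.exists_neg hz hz' x
  -- The common identity `z` is both the `M'`-sum of `g, g'` and the `M`-sum of `x, x'`. The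
  -- bialgebra law gives a summand `a₁` shared by `g` and `x`, which lies in both components.
  obtain ⟨a₁, a₂, b₁, b₂, h₁, -, h₃, -⟩ :=
    (hC.bialgebra g g' x x').1 ⟨z, hC.right.comm hg', hC.left.comm hx'⟩
  refine ⟨a₁, Subtype.ext ?_, Subtype.ext ?_⟩
  · rw [← hC.left.unit_left h₁, hC.left.unit_of_mem g.2]
  · rw [← hC.right.unit_left h₃, hC.right.unit_of_mem x.2]

/-- Two complementary abelian groupoid structures form a grid. -/
noncomputable def unitEquiv (hC : ComplementaryRel M E M' E') : S ≃ {a // E a} × {a // E' a} :=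
  Equiv.ofBijective (fun a => (hC.left.unit a, hC.right.unit a))
    ⟨fun _ _ h => hC.unit_prod_injective (congrArg Prod.fst h) (congrArg Prod.snd h),
      fun p => (hC.exists_of_units p.1 p.2).imp fun _ h => Prod.ext h.1 h.2⟩

theorem rel_iff (hC : ComplementaryRel M E M' E') (a b c : S) :
    M a b c ↔ hC.left.unit a = hC.left.unit b ∧ hC.left.unit c = hC.left.unit a ∧
      hC.right.unit c = letI := hC.unitGroup; hC.right.unit a + hC.right.unit b := by
  have key : ∀ {c}, M a b c → hC.left.unit c = hC.left.unit a ∧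
      hC.right.unit c = letI := hC.unitGroup; hC.right.unit a + hC.right.unit b :=
    fun h => ⟨hC.left.unit_left h, (hC.unitGroup_rel _ _ _).1 (hC.symm.unit_rel h)⟩
  refine ⟨fun h => ⟨(hC.left.unit_left h).symm.trans (hC.left.unit_right h), key h⟩, ?_⟩
  rintro ⟨h, h₁, h₂⟩
  obtain ⟨d, hd⟩ := hC.left.exists_rel h
  rwa [hC.unit_prod_injective (h₁.trans (key hd).1.symm) (h₂.trans (key hd).2.symm)]

end ComplementaryRel

/-! ## Frobenius algebras in `FRel` -/

namespace FRel

theorem rel_iff_of_eq {A B : FRel.{u}} {f g : A ⟶ B} (h : f = g) (a : A) (b : B) :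
    f.rel a b ↔ g.rel a b := by rw [h]

theorem eq_id_of_isIso_unit (N : 𝟙_ FRel.{u} ⟶ 𝟙_ FRel.{u}) [IsIso N] : N = 𝟙 _ := by
  refine hom_ext fun ⟨⟩ ⟨⟩ => ⟨fun _ => rfl, fun _ => ?_⟩
  obtain ⟨⟨⟩, h, -⟩ := (rel_iff_of_eq (IsIso.hom_inv_id N) ⟨⟩ ⟨⟩).2 rfl
  exact h

theorem exists_equiv_of_iso {A B : FRel.{u}} (h : A ≅ B) :
    ∃ f : A ≃ B, ∀ a b, h.hom.rel a b ↔ f a = b := by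
  have hl := rel_iff_of_eq h.hom_inv_id
  have hr := rel_iff_of_eq h.inv_hom_id
  choose f hf hf' using fun a => (hl a a).2 rfl
  have hu : ∀ {a b}, h.hom.rel a b → f a = b := fun {a b} hab => (hr _ _).1 ⟨a, hf' a, hab⟩
  refine ⟨Equiv.ofBijective f ⟨fun a a' haa => ?_, fun b => ?_⟩, fun a b => ⟨hu, ?_⟩⟩
  · exact (hl a a').1 ⟨f a, hf a, haa ▸ hf' a'⟩
  · obtain ⟨a, -, ha⟩ := (hr b b).2 rfl
    exact ⟨a, hu ha⟩
  · rintro rfl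
    exact hf a

variable {A : FRel.{u}}

theorem isAbelianRel (F : DaggerFrobenius A) (hq : F.IsQuasiSpecial) (hc : F.IsCommutative) :
    IsAbelianRel (fun a b c => F.mul.rel (a, b) c) (F.one.rel ⟨⟩) := by
  obtain ⟨N, hN, hq⟩ := hq
  rw [eq_id_of_isIso_unit N] at hq
  have comm : ∀ {a b c}, F.mul.rel (a, b) c → F.mul.rel (b, a) c := fun {a b c} h =>
    (rel_iff_of_eq hc (b, a) c).1 ⟨(a, b), rfl, h⟩
  have unit_eq : ∀ {e a c}, F.one.rel ⟨⟩ e → F.mul.rel (e, a) c → a = c := fun {e a c} he h =>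
    (rel_iff_of_eq F.one_mul (⟨⟩, a) c).1 ⟨(e, a), ⟨he, rfl⟩, h⟩
  refine ⟨fun {a b c d} h h' => ?_, comm, fun {a b c x y} h h' => ?_, unit_eq, fun a => ?_,
    fun {e a} he h => ?_⟩
  · obtain ⟨⟨⟨⟩, x⟩, h₁, ⟨⟨⟩, x'⟩, ⟨-, h₂⟩, h₃⟩ := (rel_iff_of_eq hq c d).1 ⟨(a, b), h, h'⟩
    exact (h₁.symm.trans h₂).trans h₃
  · obtain ⟨⟨_, _⟩, h₁, ⟨_, z⟩, ⟨h₂, h₃⟩, h₄⟩ :=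
      (rel_iff_of_eq F.mul_assoc ((a, b), c) y).1 ⟨(x, c), ⟨h, rfl⟩, h'⟩
    cases h₁
    cases h₂
    exact ⟨z, h₃, h₄⟩
  · obtain ⟨⟨e, _⟩, ⟨he, h₁⟩, h₂⟩ := (rel_iff_of_eq F.one_mul (⟨⟩, a) a).2 rfl
    cases h₁
    exact ⟨e, he, h₂⟩
  · obtain ⟨⟨_, x, _⟩, ⟨-, h₁⟩, ⟨⟨_, _⟩, _⟩, h₂, h₃, h₄⟩ :=
      (rel_iff_of_eq F.frobenius_left (a, e) (e, a)).2 ⟨a, comm h, h⟩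
    cases h₂
    cases h₄
    exact ⟨_, h₁⟩

theorem copy_iff {Z X : DaggerFrobenius A}
    (h : X.one ≫ Z.comul = (λ_ (𝟙_ FRel.{u})).inv ≫ (X.one ⊗ₘ X.one)) (a b : A) :
    (∃ c, X.one.rel ⟨⟩ c ∧ Z.mul.rel (a, b) c) ↔ X.one.rel ⟨⟩ a ∧ X.one.rel ⟨⟩ b := by
  refine (rel_iff_of_eq h ⟨⟩ (a, b)).trans ?_
  exact ⟨fun ⟨⟨⟨⟩, ⟨⟩⟩, _, h⟩ => h, fun h => ⟨(⟨⟩, ⟨⟩), rfl, h⟩⟩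

theorem complementaryRel (𝔾 : InternalGroup A) (h𝔾 : 𝔾.IsAbelian) :
    ComplementaryRel (fun a b c => 𝔾.Z.mul.rel (a, b) c) (𝔾.Z.one.rel ⟨⟩)
      (fun a b c => 𝔾.X.mul.rel (a, b) c) (𝔾.X.one.rel ⟨⟩) where
  left := isAbelianRel 𝔾.Z 𝔾.quasiSpecial_Z 𝔾.commutative_Z
  right := isAbelianRel 𝔾.X 𝔾.quasiSpecial_X h𝔾
  copy_left := copy_iff 𝔾.stronglyComplementary.coherent.copy_left
  copy_right := copy_iff 𝔾.stronglyComplementary.coherent.copy_right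
  bialgebra a b c d := by
    refine (rel_iff_of_eq 𝔾.stronglyComplementary.bialgebra (a, b) (c, d)).trans ?_
    constructor
    · rintro ⟨⟨⟨a₁, a₂⟩, b₁, b₂⟩, ⟨h₁, h₂⟩, q, hq, h₃⟩
      rw [tensorμ_rel] at hq
      subst hq
      exact ⟨a₁, a₂, b₁, b₂, h₁, h₂, h₃⟩
    · rintro ⟨a₁, a₂, b₁, b₂, h₁, h₂, h₃⟩
      exact ⟨((a₁, a₂), (b₁, b₂)), ⟨h₁, h₂⟩, ((a₁, b₁), (a₂, b₂)),
        (tensorμ_rel _ _ _ _ _ _).2 rfl, h₃⟩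
  exists_common := by
    obtain ⟨z, hz, hz'⟩ :=
      (rel_iff_of_eq 𝔾.stronglyComplementary.coherent.unit_counit ⟨⟩ ⟨⟩).2 rfl
    exact ⟨z, hz', hz⟩

/-- The underlying set of an abelian internal group is a product of two groups; the point structure
adds second coordinates, the group structure adds first coordinates. -/
theorem exists_equiv_prod (𝔾 : InternalGroup A) (h𝔾 : 𝔾.IsAbelian) :
    ∃ (G H : Type u) (_ : AddCommGroup G) (_ : AddCommGroup H) (e : A ≃ G × H),
      (∀ a b c, 𝔾.Z.mul.rel (a, b) c ↔
        (e a).1 = (e b).1 ∧ (e c).1 = (e a).1 ∧ (e c).2 = (e a).2 + (e b).2) ∧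
      ∀ a b c, 𝔾.X.mul.rel (a, b) c ↔
        (e a).2 = (e b).2 ∧ (e c).2 = (e a).2 ∧ (e c).1 = (e a).1 + (e b).1 :=
  have hC := complementaryRel 𝔾 h𝔾
  ⟨_, _, hC.symm.unitGroup, hC.unitGroup, hC.unitEquiv, hC.rel_iff, hC.symm.rel_iff⟩

end FRel

/-! ### Copies of a group and their invariance under bijections -/

theorem correspondsToCopies_of_equiv {A : FRel.{u}} {F : DaggerFrobenius A} {ι K : Type*}
    [AddCommGroup K] (e : A ≃ ι × K) (he : ∀ a b c, F.mul.rel (a, b) c ↔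
      (e a).1 = (e b).1 ∧ (e c).1 = (e a).1 ∧ (e c).2 = (e a).2 + (e b).2) :
    CorrespondsToCopies F ι K := by
  let ε (i : ι) : {a | (e a).1 = i} ≃ K :=
    { toFun := fun a => (e a).2
      invFun := fun k => ⟨e.symm (i, k), by simp⟩
      left_inv := fun ⟨a, ha⟩ => Subtype.ext (e.symm_apply_eq.2 (Prod.ext ha.symm rfl))
      right_inv := fun k => by simp }
  refine ⟨⟨fun i => {a | (e a).1 = i}, fun i => (ε i).addCommGroup, fun a => ⟨_, rfl, ?_⟩⟩,
    fun a b c => ?_, fun i => ?_⟩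
  · rintro i rfl
    rfl
  · rw [he]
    constructor
    · rintro ⟨h, h₁, h₂⟩
      refine ⟨(e a).1, rfl, h.symm, ?_⟩
      exact e.injective (Prod.ext (by simp [ε, Equiv.add_def, h₁]) (by simp [ε, Equiv.add_def, h₂]))
    · rintro ⟨i, rfl, hb, rfl⟩
      exact ⟨hb.symm, by simp [ε, Equiv.add_def], by simp [ε, Equiv.add_def]⟩
  · let := (ε i).addCommGroup
    exact ⟨(ε i).addEquiv⟩

/-- A bijection that intertwines two multiplications maps the members of an abelian groupoid
isomorphically onto members of the other. -/
theorem AbelianGroupoid.CorrespondsTo.exists_addEquiv {ι κ : Type*} {A B : FRel.{u}}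
    {P : AbelianGroupoid ι A} {Q : AbelianGroupoid κ B} {F : DaggerFrobenius A}
    {F' : DaggerFrobenius B} (hP : P.CorrespondsTo F) (hQ : Q.CorrespondsTo F') (f : A ≃ B)
    (hf : ∀ a b c, F.mul.rel (a, b) c ↔ F'.mul.rel (f a, f b) (f c)) (i : ι) :
    ∃ j, Nonempty (P.part i ≃+ Q.part j) := by
  obtain ⟨j, hj, -⟩ := Q.existsUnique_mem (f (0 : P.part i))
  -- Membership in the part of `0` means that the sum with `0` is defined, a condition that `f`
  -- preserves.
  have mem_iff : ∀ a, a ∈ P.part i ↔ f a ∈ Q.part j := by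
    intro a
    have h₁ : (∃ c, F.mul.rel ((0 : P.part i).1, a) c) ↔ a ∈ P.part i := by
      refine ⟨fun ⟨c, hc⟩ => ?_, fun ha => ⟨_, (hP _ _ _).2 ⟨i, (0 : P.part i).2, ha, rfl⟩⟩⟩
      obtain ⟨k, h0, ha, -⟩ := (hP _ _ _).1 hc
      rwa [(P.existsUnique_mem _).unique (0 : P.part i).2 h0]
    have h₂ : (∃ c, F'.mul.rel (f (0 : P.part i).1, f a) c) ↔ f a ∈ Q.part j := by
      refine ⟨fun ⟨c, hc⟩ => ?_, fun ha => ⟨_, (hQ _ _ _).2 ⟨j, hj, ha, rfl⟩⟩⟩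
      obtain ⟨k, h0, ha, -⟩ := (hQ _ _ _).1 hc
      rwa [(Q.existsUnique_mem _).unique hj h0]
    rw [← h₁, ← h₂, ← f.exists_congr_right]
    simp only [hf]
  refine ⟨j, ⟨{ f.subtypeEquiv mem_iff with map_add' := fun a b => ?_ }⟩⟩
  obtain ⟨k, ha, hb, h⟩ := (hQ _ _ _).1 ((hf _ _ _).1 ((hP a b _).2 ⟨i, a.2, b.2, rfl⟩))
  obtain rfl := (Q.existsUnique_mem _).unique ha ((mem_iff _).1 a.2)
  exact Subtype.ext h

/-- With `f` the identity, this shows that the algebra determines the group up to isomorphism; with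
`f` a Hadamard transform, it compares `X` with `Z`. -/
theorem CorrespondsToCopies.nonempty_addEquiv {ι κ K L : Type*} [AddCommGroup K] [AddCommGroup L]
    [Nonempty ι] {A B : FRel.{u}} {F : DaggerFrobenius A} {F' : DaggerFrobenius B}
    (hF : CorrespondsToCopies F ι K) (hF' : CorrespondsToCopies F' κ L) (f : A ≃ B)
    (hf : ∀ a b c, F.mul.rel (a, b) c ↔ F'.mul.rel (f a, f b) (f c)) : Nonempty (K ≃+ L) := by
  obtain ⟨P, hP, hK⟩ := hF
  obtain ⟨Q, hQ, hL⟩ := hF'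
  obtain ⟨j, ⟨φ⟩⟩ := hP.exists_addEquiv hQ f hf (Classical.arbitrary ι)
  exact ⟨((hK _).some.symm.trans φ).trans (hL j).some⟩

/-! ### Hadamard transforms as bijections -/

namespace InternalGroup

variable {A : FRel.{u}} {𝔾 : InternalGroup A}

theorem Hadamard.exists_equiv (h : 𝔾.Hadamard) :
    ∃ f : A ≃ A, ∀ a b c, 𝔾.X.mul.rel (a, b) c ↔ 𝔾.Z.mul.rel (f a, f b) (f c) := by
  obtain ⟨f, hf⟩ := FRel.exists_equiv_of_iso h.h
  refine ⟨f, fun a b c => ?_⟩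
  have key := FRel.rel_iff_of_eq h.map_mul (a, b) (f c)
  simp only [FRel.comp_rel, FRel.tensorHom_rel, hf] at key
  constructor
  · intro hc
    obtain ⟨⟨_, _⟩, ⟨rfl, rfl⟩, h'⟩ := key.1 ⟨c, hc, rfl⟩
    exact h'
  · intro hc
    obtain ⟨d, hd, hdc⟩ := key.2 ⟨(f a, f b), ⟨rfl, rfl⟩, hc⟩
    exact f.injective hdc ▸ hd

/-- A bijection that exchanges the two multiplications is a Hadamard transform. -/
theorem nonempty_hadamard (h𝔾 : 𝔾.IsAbelian) (f : A ≃ A)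
    (hXZ : ∀ a b c, 𝔾.X.mul.rel (a, b) c ↔ 𝔾.Z.mul.rel (f a, f b) (f c))
    (hZX : ∀ a b c, 𝔾.Z.mul.rel (a, b) c ↔ 𝔾.X.mul.rel (f a, f b) (f c)) :
    Nonempty 𝔾.Hadamard := by
  have hC := FRel.complementaryRel 𝔾 h𝔾
  -- Identities are determined by the addition (`mem_iff`), so `f` transports them automatically.
  have oneXZ : ∀ a, 𝔾.X.one.rel ⟨⟩ a ↔ 𝔾.Z.one.rel ⟨⟩ (f a) := fun a => by
    rw [hC.right.mem_iff, hC.left.mem_iff]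
    exact f.forall_congr fun {b} => f.forall_congr fun {c} => by simp [hXZ]
  have oneZX : ∀ a, 𝔾.Z.one.rel ⟨⟩ a ↔ 𝔾.X.one.rel ⟨⟩ (f a) := fun a => by
    rw [hC.right.mem_iff, hC.left.mem_iff]
    exact f.forall_congr fun {b} => f.forall_congr fun {c} => by simp [hZX]
  refine ⟨⟨FRel.isoOfEquiv f, ?_, ?_, ?_, ?_⟩⟩
  · refine FRel.hom_ext fun a ⟨b, c⟩ => ?_
    constructor
    · rintro ⟨_, rfl, h⟩
      refine ⟨(f.symm b, f.symm c), (hZX _ _ _).2 ?_, f.apply_symm_apply b, f.apply_symm_apply c⟩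
      simpa using (show 𝔾.X.mul.rel (b, c) (f a) from h)
    · rintro ⟨⟨b, c⟩, h, rfl, rfl⟩
      exact ⟨_, rfl, (hZX _ _ _).1 h⟩
  · refine FRel.hom_ext fun a ⟨⟩ => ?_
    exact ⟨fun ⟨_, h, h'⟩ => (oneZX a).2 (h ▸ h'), fun h => ⟨_, rfl, (oneZX a).1 h⟩⟩
  · refine FRel.hom_ext fun ⟨a, b⟩ c => ?_
    constructor
    · rintro ⟨c, h, rfl⟩
      exact ⟨(f a, f b), ⟨rfl, rfl⟩, (hXZ _ _ _).1 h⟩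
    · rintro ⟨⟨_, _⟩, ⟨rfl, rfl⟩, h⟩
      exact ⟨f.symm c, (hXZ _ _ _).2 (by simpa using h), f.apply_symm_apply c⟩
  · refine FRel.hom_ext fun ⟨⟩ a => ?_
    constructor
    · rintro ⟨a, h, rfl⟩
      exact (oneXZ a).1 h
    · intro h
      exact ⟨f.symm a, (oneXZ _).2 (by simpa using h), f.apply_symm_apply a⟩

end InternalGroup

theorem mainTheorem10 (A : FRel.{u}) (𝔾 : InternalGroup A) (h𝔾 : 𝔾.IsAbelian) :
    (∃ (G H : Type u) (_ : AddCommGroup G) (_ : AddCommGroup H),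
      Finite G ∧ Finite H ∧ CorrespondsToCopies 𝔾.Z G H ∧ CorrespondsToCopies 𝔾.X H G) ∧
    ∀ (G : Type*) (H : Type*) [AddCommGroup G] [AddCommGroup H] [Finite G] [Finite H],
      CorrespondsToCopies 𝔾.Z G H → CorrespondsToCopies 𝔾.X H G →
        (Nonempty 𝔾.Hadamard ↔ Nonempty (G ≃+ H)) := by
  obtain ⟨G₀, H₀, _, _, e, hZ, hX⟩ := FRel.exists_equiv_prod 𝔾 h𝔾
  have cZ : CorrespondsToCopies 𝔾.Z G₀ H₀ := correspondsToCopies_of_equiv e hZ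
  have cX : CorrespondsToCopies 𝔾.X H₀ G₀ :=
    correspondsToCopies_of_equiv (e.trans (Equiv.prodComm G₀ H₀)) hX
  refine ⟨⟨G₀, H₀, _, _, Finite.of_surjective (fun a => (e a).1)
      (Prod.fst_surjective.comp e.surjective), Finite.of_surjective (fun a => (e a).2)
      (Prod.snd_surjective.comp e.surjective), cZ, cX⟩, fun G H _ _ _ _ hG hH => ⟨?_, ?_⟩⟩
  · rintro ⟨h⟩
    obtain ⟨f, hf⟩ := h.exists_equiv
    exact hH.nonempty_addEquiv hG f hf
  · rintro ⟨φ⟩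
    -- The given `G` and `H` need not be the constructed `G₀` and `H₀`, but are isomorphic to them.
    obtain ⟨ψ⟩ := hG.nonempty_addEquiv cZ (Equiv.refl A) fun _ _ _ => Iff.rfl
    obtain ⟨χ⟩ := hH.nonempty_addEquiv cX (Equiv.refl A) fun _ _ _ => Iff.rfl
    let θ : G₀ ≃+ H₀ := (χ.symm.trans φ).trans ψ
    let f : A ≃ A := (e.trans
      ((Equiv.prodComm G₀ H₀).trans (θ.symm.toEquiv.prodCongr θ.toEquiv))).trans e.symm
    have hf : ∀ a, e (f a) = (θ.symm (e a).2, θ (e a).1) := fun a =>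
      e.apply_symm_apply _
    refine InternalGroup.nonempty_hadamard h𝔾 f (fun a b c => ?_) (fun a b c => ?_)
    · simp only [hX, hZ, hf, EmbeddingLike.apply_eq_iff_eq, ← map_add]
    · simp only [hX, hZ, hf, EmbeddingLike.apply_eq_iff_eq, ← map_add]
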